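/- Let $(M^m,g)$ and $(N^n,h)$ be smooth Riemannian manifolds without boundary, and let $\varphi:(M,g)\to(N,h)$ be a smooth harmonic map, that is, a critical point of the Dirichlet energy $E(\psi)=\frac12\int_M\|d\psi\|^2\,\mathrm{vol}_g$ with respect to compactly supported smooth variations (the energy being taken over a compact set outside which the variation is constant). The Jacobi operator of $\varphi$ is the linear differential operator $J$ on the space $\Gamma(\varphi^{-1}TN)$ of smooth sections of the pullback bundle that is determined by $$\left.\frac{\partial^2}{\partial s\,\partial t}E(\varphi_{s,t})\right|_{s=t=0}=\int_M h(X,JY)\,\mathrm{vol}_g$$ for all compactly supported smooth two-parameter variations $\varphi_{s,t}$ of $\varphi=\varphi_{0,0}$, where $X=\partial_s\varphi_{s,t}|_{s=t=0}$ and $Y=\partial_t\varphi_{s,t}|_{s=t=0}$. Let $J$ be the Jacobi operator of $\varphi:(M,g)\to(N,h)$, let $R_1,R_2>0$ be constants, and put $\tilde g=R_1^2\,g$, $\tilde h=R_2^2\,h$. Then $\varphi:(M,\tilde g)\to(N,\tilde h)$ is harmonic, and $R_1^{-2}J$ is its Jacobi operator, and the only one: $\tilde J=R_1^{-2}J$,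 independently of $R_2$. -/

import Mathlib

open Bundle Set MeasureTheory
open scoped Manifold ContDiff Topology Matrix

noncomputable section

namespace HarmonicMaps

/-- The Euclidean model space of dimension `k`. -/
abbrev Euc (k : ℕ) : Type := EuclideanSpace ℝ (Fin k)

/-- The standard basis of the model space. -/
def stdVec {k : ℕ} (i : Fin k) : Euc k := EuclideanSpace.single i 1

/-- Smooth Riemannian metrics on a smooth manifold of dimension `k`. -/
abbrev Metric (k : ℕ) (P : Type*) [TopologicalSpace P] [ChartedSpace (Euc k) P]
    [IsManifold (𝓡 k) ∞ P] :=
  ContMDiffRiemannianMetric (𝓡 k) ∞ (Euc k) (fun x : P => TangentSpace (𝓡 k) x)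

set_option synthInstance.maxHeartbeats 400000 in
/-- The homothetic metric `R ^ 2 • g`. -/
def Metric.rescale {k : ℕ} {P : Type*} [TopologicalSpace P] [ChartedSpace (Euc k) P]
    [IsManifold (𝓡 k) ∞ P] (g : Metric k P) (R : ℝ) (hR : 0 < R) : Metric k P where
  inner x := R ^ 2 • g.inner x
  symm x v w := by
    change R ^ 2 * g.inner x v w = R ^ 2 * g.inner x w v
    rw [g.symm x v w]
  pos x v hv := by
    change 0 < R ^ 2 * g.inner x v v
    exact mul_pos (pow_pos hR 2) (g.pos x v hv)
  isVonNBounded x := by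
    have h := (g.isVonNBounded x).image
      (R⁻¹ • ContinuousLinearMap.id ℝ (TangentSpace (𝓡 k) x))
    refine h.subset ?_
    intro v hv
    have hv' : R ^ 2 * g.inner x v v < 1 := hv
    refine ⟨R • v, ?_, ?_⟩
    · change g.inner x (R • v) (R • v) < 1
      simp only [map_smul, _root_.smul_apply, smul_eq_mul]
      nlinarith
    · change R⁻¹ • (R • v) = v
      rw [smul_smul, inv_mul_cancel₀ hR.ne', one_smul]
  contMDiff := by
    have := ContMDiff.const_smul_section (a := R ^ 2) g.contMDiff
    exact this

section Volume

variable {m : ℕ} {M : Type*} [TopologicalSpace M] [ChartedSpace (Euc m) M]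
  [IsManifold (𝓡 m) ∞ M]

/-- The matrix `g_ij` of the metric in the coordinates of the chart at `x`, at the point `u` of the
coordinate domain. -/
def chartGram (g : Metric m M) (x : M) (u : Euc m) : Matrix (Fin m) (Fin m) ℝ :=
  Matrix.of fun i j =>
    g.inner ((chartAt (Euc m) x).symm u)
      (mfderiv (𝓡 m) (𝓡 m) (chartAt (Euc m) x).symm u (stdVec i))
      (mfderiv (𝓡 m) (𝓡 m) (chartAt (Euc m) x).symm u (stdVec j))

/-- The measure `√(det g_ij) du` of the chart at `x`, as a measure on `M` (carried by the domain of
this chart). -/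
def chartVolume [MeasurableSpace M] (g : Metric m M) (x : M) : Measure M :=
  ((volume.restrict (chartAt (Euc m) x).target).withDensity
    fun u => ENNReal.ofReal (Real.sqrt (chartGram g x u).det)).map (chartAt (Euc m) x).symm

variable [T2Space M] [SigmaCompactSpace M]

variable (m M) in
/-- A smooth partition of unity subordinate to the cover of `M` by the domains of its charts. -/
def chartPartition : SmoothPartitionOfUnity M (𝓡 m) M univ :=
  (SmoothPartitionOfUnity.exists_isSubordinate_chartAt_source (𝓡 m) M).choose

/-- The Riemannian volume measure of `(M, g)`: the chart measures `√(det g_ij) du`, glued by a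
partition of unity. (As the chart measures agree on overlaps, the partition is immaterial.) -/
def riemannianVolume [MeasurableSpace M] (g : Metric m M) : Measure M :=
  Measure.sum fun x =>
    (chartVolume g x).withDensity fun p => ENNReal.ofReal (chartPartition m M x p)

end Volume

section Maps

theorem eventually_mem_trivialization {m n : ℕ} {M N : Type*} [TopologicalSpace M]
    [ChartedSpace (Euc m) M] [TopologicalSpace N] [ChartedSpace (Euc n) N] [IsManifold (𝓡 n) ∞ N]
    (φ : C^∞⟮𝓡 m, M; 𝓡 n, N⟯) (p : M) :
    ∀ᶠ q in 𝓝 p, φ q ∈ (trivializationAt (Euc n) (TangentSpace (𝓡 n)) (φ p)).baseSet :=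
  φ.contMDiff.continuous.continuousAt.preimage_mem_nhds
    ((trivializationAt (Euc n) (TangentSpace (𝓡 n)) (φ p)).open_baseSet.mem_nhds
      (mem_baseSet_trivializationAt _ _ _))

variable {m n : ℕ} {M N : Type*} [TopologicalSpace M] [ChartedSpace (Euc m) M]
  [IsManifold (𝓡 m) ∞ M] [TopologicalSpace N] [ChartedSpace (Euc n) N] [IsManifold (𝓡 n) ∞ N]

/-- The matrix of the metric `g` on `T_p M`, in the basis `stdVec` of
`TangentSpace (𝓡 m) p = Euc m`. -/
def gram (g : Metric m M) (p : M) : Matrix (Fin m) (Fin m) ℝ :=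
  Matrix.of fun i j =>
    g.inner p (stdVec i : TangentSpace (𝓡 m) p) (stdVec j : TangentSpace (𝓡 m) p)

/-- `‖dψ‖² = ∑ᵢⱼ gⁱʲ h(dψ eᵢ, dψ eⱼ)` at `p`, the squared Hilbert-Schmidt norm of
`dψ : (T_p M, g) → (T_{ψ p} N, h)`. -/
def normSqDifferential (g : Metric m M) (h : Metric n N) (ψ : M → N) (p : M) : ℝ :=
  ∑ i, ∑ j, (gram g p)⁻¹ i j *
    h.inner (ψ p) (mfderiv (𝓡 m) (𝓡 n) ψ p (stdVec i)) (mfderiv (𝓡 m) (𝓡 n) ψ p (stdVec j))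

/-- `Γ(φ⁻¹TN)`, the space of smooth sections of the pullback of the tangent bundle of `N`: the
families `Y p ∈ T_{φ p} N` which depend smoothly on `p`. -/
def PullbackSection (φ : C^∞⟮𝓡 m, M; 𝓡 n, N⟯) :
    Submodule ℝ (∀ p : M, TangentSpace (𝓡 n) (φ p)) where
  carrier := {Y | ContMDiff (𝓡 m) (𝓡 n).tangent ∞ fun p => (⟨φ p, Y p⟩ : TangentBundle (𝓡 n) N)}
  add_mem' {X Y} hX hY p := by
    have hX' := contMDiffAt_totalSpace.1 (hX p)
    have hY' := contMDiffAt_totalSpace.1 (hY p)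
    refine contMDiffAt_totalSpace.2 ⟨hX'.1, (hX'.2.add hY'.2).congr_of_eventuallyEq ?_⟩
    filter_upwards [eventually_mem_trivialization φ p] with q hq
    exact ((trivializationAt (Euc n) (TangentSpace (𝓡 n)) (φ p)).linear ℝ hq).map_add _ _
  zero_mem' p := by
    refine contMDiffAt_totalSpace.2 ⟨φ.contMDiff p,
      (contMDiffAt_const (c := (0 : Euc n))).congr_of_eventuallyEq ?_⟩
    filter_upwards [eventually_mem_trivialization φ p] with q hq
    exact ((trivializationAt (Euc n) (TangentSpace (𝓡 n)) (φ p)).linear ℝ hq).map_zero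
  smul_mem' c Y hY p := by
    have hc : ContMDiffAt (𝓡 m) 𝓘(ℝ, ℝ) ∞ (fun _ : M => c) p := contMDiffAt_const
    have hY' := contMDiffAt_totalSpace.1 (hY p)
    refine contMDiffAt_totalSpace.2 ⟨hY'.1, (hc.smul hY'.2).congr_of_eventuallyEq ?_⟩
    filter_upwards [eventually_mem_trivialization φ p] with q hq
    exact ((trivializationAt (Euc n) (TangentSpace (𝓡 n)) (φ p)).linear ℝ hq).map_smul _ _

variable [T2Space M] [SigmaCompactSpace M] [MeasurableSpace M]

/-- The Dirichlet energy `½ ∫_K ‖dψ‖²` of `ψ` over `K`. -/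
def energyOn (g : Metric m M) (h : Metric n N) (K : Set M) (ψ : M → N) : ℝ :=
  (1 / 2) * ∫ p in K, normSqDifferential g h ψ p ∂(riemannianVolume g)

/-- `Φ` is a smooth one-parameter variation of `φ`, which moves points of `K` only. -/
structure IsVariation (φ : M → N) (K : Set M) (Φ : ℝ × M → N) : Prop where
  zero : ∀ p, Φ (0, p) = φ p
  exists_pos : ∃ ε > 0,
    ContMDiffOn (𝓘(ℝ, ℝ).prod (𝓡 m)) (𝓡 n) ∞ Φ (Ioo (-ε) ε ×ˢ univ) ∧
    ∀ t ∈ Ioo (-ε) ε, ∀ p ∉ K, Φ (t, p) = φ p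

/-- `φ` is harmonic: it is smooth, and a critical point of the energy with respect to compactly
supported smooth variations (all smooth variations, if `M` is compact). -/
def IsHarmonic (g : Metric m M) (h : Metric n N) (φ : M → N) : Prop :=
  ContMDiff (𝓡 m) (𝓡 n) ∞ φ ∧
    ∀ (K : Set M) (Φ : ℝ × M → N), IsCompact K → IsVariation (m := m) (n := n) φ K Φ →
      HasDerivAt (fun t => energyOn g h K fun p => Φ (t, p)) 0 0

/-- `Φ` is a smooth two-parameter variation `(s, t) ↦ φ_{s,t}` of `φ`, which moves points of `K`
only, with `∂_s φ_{s,t} = X` and `∂_t φ_{s,t} = Y` at `s = t = 0`. -/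
structure IsVariation₂ (φ : C^∞⟮𝓡 m, M; 𝓡 n, N⟯) (K : Set M) (X Y : PullbackSection φ)
    (Φ : ℝ × ℝ × M → N) : Prop where
  zero : ∀ p, Φ (0, 0, p) = φ p
  exists_pos : ∃ ε > 0,
    ContMDiffOn (𝓘(ℝ, ℝ).prod (𝓘(ℝ, ℝ).prod (𝓡 m))) (𝓡 n) ∞ Φ
      (Ioo (-ε) ε ×ˢ Ioo (-ε) ε ×ˢ univ) ∧
    ∀ s ∈ Ioo (-ε) ε, ∀ t ∈ Ioo (-ε) ε, ∀ p ∉ K, Φ (s, t, p) = φ p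
  velocity_s : ∀ p, tangentMap 𝓘(ℝ, ℝ) (𝓡 n) (fun s : ℝ => Φ (s, 0, p)) ⟨0, (1 : ℝ)⟩ =
    (⟨φ p, X.1 p⟩ : TangentBundle (𝓡 n) N)
  velocity_t : ∀ p, tangentMap 𝓘(ℝ, ℝ) (𝓡 n) (fun t : ℝ => Φ (0, t, p)) ⟨0, (1 : ℝ)⟩ =
    (⟨φ p, Y.1 p⟩ : TangentBundle (𝓡 n) N)

/-- `J` is the Jacobi operator of `φ : (M, g) → (N, h)`: the linear differential operator on
`Γ(φ⁻¹TN)` with `∂²/∂s∂t E(φ_{s,t}) = ∫_M h(X, J Y)` at `s = t = 0`, for all compactly supported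
smooth two-parameter variations `φ_{s,t}` of `φ` (all smooth ones, if `M` is compact) with
`∂_s φ_{s,t} = X` and `∂_t φ_{s,t} = Y` at `s = t = 0`. The field `isLocal` says that the linear
operator `J` does not increase supports, that is, that it is a differential operator. -/
structure IsJacobiOperator (g : Metric m M) (h : Metric n N) (φ : C^∞⟮𝓡 m, M; 𝓡 n, N⟯)
    (J : PullbackSection φ →ₗ[ℝ] PullbackSection φ) : Prop where
  isLocal : ∀ (Y : PullbackSection φ) (p : M), (∀ᶠ q in 𝓝 p, Y.1 q = 0) → (J Y).1 p = 0
  hessian : ∀ (K : Set M) (X Y : PullbackSection φ) (Φ : ℝ × ℝ × M → N),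
    IsCompact K → IsVariation₂ φ K X Y Φ →
      HasDerivAt (fun s => deriv (fun t => energyOn g h K fun p => Φ (s, t, p)) 0)
        (∫ p, h.inner (φ p) (X.1 p) ((J Y).1 p) ∂(riemannianVolume g)) 0

end Maps

end HarmonicMaps

end

noncomputable section

namespace HarmonicMaps

/-! ### Behaviour of energy, harmonicity and Jacobi operators under homotheties -/

section Rescale

variable {m n : ℕ} {M N : Type*} [TopologicalSpace M] [ChartedSpace (Euc m) M]
  [IsManifold (𝓡 m) ∞ M] [TopologicalSpace N] [ChartedSpace (Euc n) N] [IsManifold (𝓡 n) ∞ N]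

/-! The squared norm `‖dψ‖²` scales by `R₁⁻² R₂²` and the volume by `R₁ ^ m`, so the energy of every
map over every set is multiplied by one constant (`energyOn_rescale`). Critical points are therefore
unchanged and the Hessian is multiplied by that constant. In `∫ h(X, JY)` the metric `h` and the
volume account for `R₂² R₁ ^ m`; the remaining factor `R₁⁻²` falls on `J`.

Uniqueness (`IsJacobiOperator.unique`) is the fundamental lemma of the calculus of variations.
Locality of `J` allows sections to be cut off near a point, so that `φ` maps their support into one
chart of `N`. There a variation affine in the chart has the prescribed velocities, and no
exponential map is needed. Testing the difference of two Jacobi operators against a cut-off of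
itself gives a nonnegative continuous integrand with zero integral. It vanishes because the
Riemannian volume is locally finite and positive on nonempty open sets. -/

theorem rescale_inner_apply (g : Metric m M) {R : ℝ} (hR : 0 < R) (p : M)
    (v w : TangentSpace (𝓡 m) p) :
    (g.rescale R hR).inner p v w = R ^ 2 * g.inner p v w := rfl

theorem gram_rescale (g : Metric m M) {R : ℝ} (hR : 0 < R) (p : M) :
    gram (g.rescale R hR) p = R ^ 2 • gram g p := rfl

theorem chartGram_rescale (g : Metric m M) {R : ℝ} (hR : 0 < R) (x : M) (u : Euc m) :
    chartGram (g.rescale R hR) x u = R ^ 2 • chartGram g x u := rfl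

/-- For singular `A` both inverses are zero by convention, so invertibility of the Gram matrix is
not needed. -/
theorem inv_smul_matrix {k : ℕ} (A : Matrix (Fin k) (Fin k) ℝ) {c : ℝ} (hc : c ≠ 0) :
    (c • A)⁻¹ = c⁻¹ • A⁻¹ := by
  by_cases hA : IsUnit A.det
  · exact Matrix.inv_smul' A (Units.mk0 c hc) hA
  · have hcA : ¬ IsUnit (c • A).det := by
      rw [Matrix.det_smul]
      simpa [isUnit_iff_ne_zero, hc] using hA
    rw [Matrix.nonsing_inv_apply_not_isUnit _ hA, Matrix.nonsing_inv_apply_not_isUnit _ hcA,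
      smul_zero]

theorem normSqDifferential_rescale (g : Metric m M) (h : Metric n N) {R₁ R₂ : ℝ} (hR₁ : 0 < R₁)
    (hR₂ : 0 < R₂) (ψ : M → N) (p : M) :
    normSqDifferential (g.rescale R₁ hR₁) (h.rescale R₂ hR₂) ψ p =
      (R₁ ^ 2)⁻¹ * R₂ ^ 2 * normSqDifferential g h ψ p := by
  simp only [normSqDifferential, gram_rescale, inv_smul_matrix _ (pow_pos hR₁ 2).ne',
    rescale_inner_apply, Finset.mul_sum, Matrix.smul_apply, smul_eq_mul]
  refine Finset.sum_congr rfl fun i _ => Finset.sum_congr rfl fun j _ => ?_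
  ring

/-- The determinant of the `m × m` Gram matrix gains `(R ^ 2) ^ m`, whose square root is `R ^ m`. -/
theorem chartVolume_rescale [MeasurableSpace M] (g : Metric m M) {R : ℝ} (hR : 0 < R) (x : M) :
    chartVolume (g.rescale R hR) x = ENNReal.ofReal (R ^ m) • chartVolume g x := by
  have hdens : (fun u => ENNReal.ofReal (Real.sqrt (chartGram (g.rescale R hR) x u).det)) =
      ENNReal.ofReal (R ^ m) • fun u => ENNReal.ofReal (Real.sqrt (chartGram g x u).det) := by
    funext u
    have hsq : Real.sqrt ((R ^ 2) ^ m) = R ^ m := by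
      rw [← pow_mul, mul_comm, pow_mul, Real.sqrt_sq (pow_nonneg hR.le m)]
    rw [chartGram_rescale, Matrix.det_smul, Fintype.card_fin, Pi.smul_apply, smul_eq_mul,
      Real.sqrt_mul (pow_nonneg (sq_nonneg R) m), hsq, ENNReal.ofReal_mul (pow_nonneg hR.le m)]
  rw [chartVolume, hdens, withDensity_smul' _ _ ENNReal.ofReal_ne_top, Measure.map_smul]
  rfl

variable [T2Space M] [SigmaCompactSpace M] [MeasurableSpace M]

theorem riemannianVolume_rescale (g : Metric m M) {R : ℝ} (hR : 0 < R) :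
    riemannianVolume (g.rescale R hR) = ENNReal.ofReal (R ^ m) • riemannianVolume g := by
  simp only [riemannianVolume, chartVolume_rescale, withDensity_smul_measure]
  ext s hs
  simp [Measure.sum_apply _ hs, ENNReal.tsum_mul_left]

theorem integral_riemannianVolume_rescale (g : Metric m M) {R : ℝ} (hR : 0 < R) (s : Set M)
    (f : M → ℝ) :
    ∫ p in s, f p ∂(riemannianVolume (g.rescale R hR)) =
      R ^ m * ∫ p in s, f p ∂(riemannianVolume g) := by
  rw [riemannianVolume_rescale, Measure.restrict_smul, integral_smul_measure,
    ENNReal.toReal_ofReal (pow_nonneg hR.le m), smul_eq_mul]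

theorem energyOn_rescale (g : Metric m M) (h : Metric n N) {R₁ R₂ : ℝ} (hR₁ : 0 < R₁)
    (hR₂ : 0 < R₂) (K : Set M) (ψ : M → N) :
    energyOn (g.rescale R₁ hR₁) (h.rescale R₂ hR₂) K ψ =
      R₁ ^ m * ((R₁ ^ 2)⁻¹ * R₂ ^ 2) * energyOn g h K ψ := by
  simp only [energyOn, normSqDifferential_rescale, integral_riemannianVolume_rescale,
    integral_const_mul]
  ring

theorem IsHarmonic.rescale {g : Metric m M} {h : Metric n N} {φ : M → N}
    (hφ : IsHarmonic g h φ) {R₁ R₂ : ℝ} (hR₁ : 0 < R₁) (hR₂ : 0 < R₂) :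
    IsHarmonic (g.rescale R₁ hR₁) (h.rescale R₂ hR₂) φ := by
  refine ⟨hφ.1, fun K Φ hK hΦ => ?_⟩
  simp only [energyOn_rescale]
  simpa using (hφ.2 K Φ hK hΦ).const_mul (R₁ ^ m * ((R₁ ^ 2)⁻¹ * R₂ ^ 2))

theorem IsJacobiOperator.rescale {g : Metric m M} {h : Metric n N} {φ : C^∞⟮𝓡 m, M; 𝓡 n, N⟯}
    {J : PullbackSection φ →ₗ[ℝ] PullbackSection φ} (hJ : IsJacobiOperator g h φ J)
    {R₁ R₂ : ℝ} (hR₁ : 0 < R₁) (hR₂ : 0 < R₂) :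
    IsJacobiOperator (g.rescale R₁ hR₁) (h.rescale R₂ hR₂) φ ((R₁ ^ 2)⁻¹ • J) := by
  refine ⟨fun Y p hY => ?_, fun K X Y Φ hK hΦ => ?_⟩
  · change (R₁ ^ 2)⁻¹ • (J Y).1 p = 0
    rw [hJ.isLocal Y p hY, smul_zero]
  · have key := (hJ.hessian K X Y Φ hK hΦ).const_mul (R₁ ^ m * ((R₁ ^ 2)⁻¹ * R₂ ^ 2))
    -- Over a field, constants leave `deriv` even where the inner derivative does not exist.
    simp only [energyOn_rescale, deriv_const_mul_field]
    refine key.congr_deriv (Eq.symm ?_)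
    have hpt : ∀ p, (h.rescale R₂ hR₂).inner (φ p) (X.1 p) ((((R₁ ^ 2)⁻¹ • J) Y).1 p) =
        ((R₁ ^ 2)⁻¹ * R₂ ^ 2) * h.inner (φ p) (X.1 p) ((J Y).1 p) := fun p => by
      change R₂ ^ 2 * h.inner (φ p) (X.1 p) ((R₁ ^ 2)⁻¹ • (J Y).1 p) = _
      rw [map_smul, smul_eq_mul]
      ring
    have hint := integral_riemannianVolume_rescale g hR₁ univ
      fun p => ((R₁ ^ 2)⁻¹ * R₂ ^ 2) * h.inner (φ p) (X.1 p) ((J Y).1 p)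
    rw [Measure.restrict_univ, Measure.restrict_univ] at hint
    refine (integral_congr_ae (Filter.Eventually.of_forall hpt)).trans (hint.trans ?_)
    rw [integral_const_mul]
    ring

end Rescale

/-! ### Regularity and positivity of the metric coefficients -/

section Smoothness

variable {m n : ℕ} {M N : Type*} [TopologicalSpace M] [ChartedSpace (Euc m) M]
  [TopologicalSpace N] [ChartedSpace (Euc n) N] [IsManifold (𝓡 n) ∞ N]

/-- The scalar product of two smooth vector fields along a map is smooth. -/
theorem contMDiffWithinAt_inner_along (h : Metric n N) {b : M → N}
    {v w : ∀ p, TangentSpace (𝓡 n) (b p)} {s : Set M} {p : M}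
    (hv : ContMDiffWithinAt (𝓡 m) (𝓡 n).tangent ∞
      (fun q => (⟨b q, v q⟩ : TangentBundle (𝓡 n) N)) s p)
    (hw : ContMDiffWithinAt (𝓡 m) (𝓡 n).tangent ∞
      (fun q => (⟨b q, w q⟩ : TangentBundle (𝓡 n) N)) s p) :
    ContMDiffWithinAt (𝓡 m) 𝓘(ℝ, ℝ) ∞ (fun q => h.inner (b q) (v q) (w q)) s p := by
  have hb : ContMDiffWithinAt (𝓡 m) (𝓡 n) ∞ b s p := (contMDiffWithinAt_totalSpace.1 hv).1
  -- The scalar function is viewed as a section of the trivial line bundle, the target of the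
  -- bilinear bundle map `h`.
  have : ContMDiffWithinAt (𝓡 m) ((𝓡 n).prod 𝓘(ℝ)) ∞
      (fun q ↦ TotalSpace.mk' ℝ (E := Bundle.Trivial N ℝ) (b q) (h.inner (b q) (v q) (w q)))
      s p := by
    apply ContMDiffWithinAt.clm_bundle_apply₂ (F₁ := Euc n) (F₂ := Euc n)
    · exact ContMDiffAt.comp_contMDiffWithinAt p h.contMDiff.contMDiffAt hb
    · exact hv
    · exact hw
  exact (contMDiffWithinAt_totalSpace.1 this).2

variable [IsManifold (𝓡 m) ∞ M]

/-- The metric coefficients in a chart are continuous. -/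
theorem continuousOn_chartGram (g : Metric m M) (x : M) :
    ContinuousOn (chartGram g x) (chartAt (Euc m) x).target := by
  have hsec : ∀ i : Fin m, ContMDiffOn (𝓡 m) (𝓡 m).tangent ∞
      (fun u => (⟨(chartAt (Euc m) x).symm u,
        mfderiv (𝓡 m) (𝓡 m) (chartAt (Euc m) x).symm u (stdVec i)⟩ : TangentBundle (𝓡 m) M))
      (chartAt (Euc m) x).target := by
    intro i
    -- Coordinate fields are images of constant fields under the tangent map of the inverse chart.
    have h1 := (contMDiffOn_chart_symm (I := 𝓡 m) (n := ∞) (x := x)).contMDiffOn_tangentMapWithin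
      (m := ∞) (by simp) (chartAt (Euc m) x).open_target.uniqueMDiffOn
    have h2 : ContMDiffOn (𝓡 m) (𝓡 m).tangent ∞
        (fun u : Euc m => (⟨u, stdVec i⟩ : TangentBundle (𝓡 m) (Euc m)))
        (chartAt (Euc m) x).target :=
      ((contMDiff_vectorSpace_iff_contDiff (V := fun _ => stdVec i)).2 contDiff_const).contMDiffOn
    refine (h1.comp h2 fun u hu => hu).congr fun u hu => ?_
    simp only [tangentMapWithin, Function.comp_apply]
    rw [mfderivWithin_of_isOpen (chartAt (Euc m) x).open_target hu]
  refine continuousOn_pi.2 fun i => continuousOn_pi.2 fun j => ?_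
  exact ContMDiffOn.continuousOn (I := 𝓡 m) (I' := 𝓘(ℝ, ℝ)) (n := ∞) fun u hu =>
    contMDiffWithinAt_inner_along g (hsec i u hu) (hsec j u hu)

/-- The quadratic form of the Gram matrix at `c` is `g(Av, Av)` with `v = ∑ cᵢ eᵢ`, and `A` is
injective as the differential of an inverse chart. -/
theorem det_chartGram_pos (g : Metric m M) (x : M) {u : Euc m}
    (hu : u ∈ (chartAt (Euc m) x).target) : 0 < (chartGram g x u).det := by
  set A := mfderiv (𝓡 m) (𝓡 m) (chartAt (Euc m) x).symm u with hA
  have hinj : Function.Injective A :=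
    (mdifferentiable_chart (I := 𝓡 m) x).symm.mfderiv_injective hu
  refine Matrix.PosDef.det_pos (Matrix.PosDef.of_dotProduct_mulVec_pos ?_ ?_)
  · ext i j
    simp only [chartGram, Matrix.conjTranspose_apply, Matrix.of_apply, star_trivial]
    exact g.symm _ _ _
  · intro c hc
    set v : Euc m := ∑ i, c i • stdVec i with hv
    have hvc : ∀ i, v i = c i := fun i => by
      simp [hv, stdVec, Pi.single_apply]
    have hv0 : v ≠ 0 := fun h0 => hc (funext fun i => by rw [← hvc, h0]; rfl)
    have hAv : A v ≠ 0 := fun h0 => hv0 (hinj (h0.trans (map_zero A).symm))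
    have hpos := g.pos _ _ hAv
    refine hpos.trans_eq ?_
    have hAsum : A v = ∑ i, c i • A (stdVec i) := by
      rw [hv]
      exact (map_sum A _ _).trans (Finset.sum_congr rfl fun i _ => map_smul A _ _)
    rw [hAsum]
    simp only [map_sum, map_smul, _root_.sum_apply, _root_.smul_apply, smul_eq_mul,
      dotProduct, Matrix.mulVec, chartGram, Matrix.of_apply, Finset.mul_sum, star_trivial,
      Pi.star_apply]
    rw [Finset.sum_comm]
    refine Finset.sum_congr rfl fun i _ => Finset.sum_congr rfl fun j _ => ?_
    rw [g.symm]
    ring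

end Smoothness

/-! ### The Riemannian volume is positive on open sets and locally finite -/

section VolumeMeasure

variable {m : ℕ} {M : Type*} [TopologicalSpace M] [ChartedSpace (Euc m) M]
  [IsManifold (𝓡 m) ∞ M]

/-- The density of the Riemannian volume in a chart. -/
def chartDensity (g : Metric m M) (x : M) (u : Euc m) : ENNReal :=
  ENNReal.ofReal (Real.sqrt (chartGram g x u).det)

theorem continuousOn_chartDensity (g : Metric m M) (x : M) :
    ContinuousOn (chartDensity g x) (chartAt (Euc m) x).target :=
  ENNReal.continuous_ofReal.comp_continuousOn
    (Real.continuous_sqrt.comp_continuousOn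
      (Continuous.matrix_det continuous_id |>.comp_continuousOn (continuousOn_chartGram g x)))

theorem chartDensity_ne_zero (g : Metric m M) (x : M) {u : Euc m}
    (hu : u ∈ (chartAt (Euc m) x).target) : chartDensity g x u ≠ 0 :=
  (ENNReal.ofReal_pos.2 (Real.sqrt_pos.2 (det_chartGram_pos g x hu))).ne'

theorem aemeasurable_chartDensity (g : Metric m M) (x : M) :
    AEMeasurable (chartDensity g x) (volume.restrict (chartAt (Euc m) x).target) :=
  (continuousOn_chartDensity g x).aemeasurable (chartAt (Euc m) x).open_target.measurableSet

theorem chartPartition_tsupport_subset [T2Space M] [SigmaCompactSpace M] (x : M) :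
    tsupport (chartPartition m M x) ⊆ (chartAt (Euc m) x).source :=
  (SmoothPartitionOfUnity.exists_isSubordinate_chartAt_source (𝓡 m) M).choose_spec x

variable [MeasurableSpace M] [BorelSpace M]

/-- `Measure.map` is zero by default off the a.e. measurable maps; the inverse chart qualifies
because it is continuous on its open target, which carries the measure. -/
theorem chartVolume_apply (g : Metric m M) (x : M) {s : Set M} (hs : MeasurableSet s) :
    chartVolume g x s = ((volume.restrict (chartAt (Euc m) x).target).withDensity
      (chartDensity g x)) ((chartAt (Euc m) x).symm ⁻¹' s) := by
  refine Measure.map_apply_of_aemeasurable ?_ hs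
  have h : AEMeasurable (chartAt (Euc m) x).symm
      (volume.restrict (chartAt (Euc m) x).target) :=
    (chartAt (Euc m) x).continuousOn_symm.aemeasurable
      (chartAt (Euc m) x).open_target.measurableSet
  exact h.mono_ac (withDensity_absolutelyContinuous _ _)

/-- In the chart, the relevant part of `U` is a nonempty open set, and the density vanishes nowhere
on it. -/
theorem chartVolume_ne_zero (g : Metric m M) (x : M) {U : Set M} (hU : IsOpen U)
    (hne : (U ∩ (chartAt (Euc m) x).source).Nonempty) : chartVolume g x U ≠ 0 := by
  obtain ⟨p, hpU, hps⟩ := hne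
  set c := chartAt (Euc m) x with hc
  have hopen : IsOpen (c.target ∩ c.symm ⁻¹' U) := c.isOpen_inter_preimage_symm hU
  rw [chartVolume_apply g x hU.measurableSet, Ne,
    withDensity_apply_eq_zero' (aemeasurable_chartDensity g x),
    Measure.restrict_apply₀' c.open_target.measurableSet.nullMeasurableSet]
  intro h0
  have hpc : c p ∈ c.target ∩ c.symm ⁻¹' U :=
    ⟨c.map_source hps, by simpa [c.left_inv hps] using hpU⟩
  refine (hopen.measure_pos volume ⟨c p, hpc⟩).ne' (measure_mono_null ?_ h0)
  exact fun u hu => ⟨⟨chartDensity_ne_zero g x hu.1, hu.2⟩, hu.1⟩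

/-- Near `c p` the continuous density stays below its value there plus one, and Lebesgue measure is
locally finite. -/
theorem chartVolume_finiteAt (g : Metric m M) (x : M) {p : M}
    (hp : p ∈ (chartAt (Euc m) x).source) : (chartVolume g x).FiniteAtFilter (𝓝 p) := by
  set c := chartAt (Euc m) x with hc
  have hct : c.target ∈ 𝓝 (c p) := c.open_target.mem_nhds (c.map_source hp)
  have hcont : ContinuousAt (chartDensity g x) (c p) :=
    (continuousOn_chartDensity g x).continuousAt hct
  have hlt : chartDensity g x (c p) < chartDensity g x (c p) + 1 :=
    ENNReal.lt_add_right ENNReal.ofReal_ne_top one_ne_zero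
  have hbd : ∀ᶠ u in 𝓝 (c p), chartDensity g x u < chartDensity g x (c p) + 1 :=
    hcont.eventually (gt_mem_nhds hlt)
  obtain ⟨S, hS, hSfin⟩ := (volume : Measure (Euc m)).finiteAt_nhds (c p)
  obtain ⟨V, hVsub, hVo, hpV⟩ := mem_nhds_iff.1 (Filter.inter_mem hbd hS)
  have hWo : IsOpen (c.source ∩ c ⁻¹' V) := c.isOpen_inter_preimage hVo
  refine ⟨c.source ∩ c ⁻¹' V, hWo.mem_nhds ⟨hp, hpV⟩, ?_⟩
  rw [chartVolume_apply g x hWo.measurableSet, withDensity_apply', Measure.restrict_restrict']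
  · calc ∫⁻ u in c.symm ⁻¹' (c.source ∩ c ⁻¹' V) ∩ c.target, chartDensity g x u
        ≤ ∫⁻ u in V, chartDensity g x u := by
          refine lintegral_mono_set fun u hu => ?_
          have : c (c.symm u) ∈ V := hu.1.2
          rwa [c.right_inv hu.2] at this
      _ ≤ ∫⁻ _ in V, (chartDensity g x (c p) + 1) :=
          setLIntegral_mono measurable_const fun u hu => (hVsub hu).1.le
      _ = (chartDensity g x (c p) + 1) * volume V := by rw [setLIntegral_const]
      _ < ⊤ := ENNReal.mul_lt_top
          (ENNReal.add_lt_top.2 ⟨ENNReal.ofReal_lt_top, ENNReal.one_lt_top⟩)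
          ((measure_mono fun u hu => (hVsub hu).2).trans_lt hSfin)
  · exact c.open_target.measurableSet

variable [T2Space M] [SigmaCompactSpace M]

/-- A single summand suffices: one whose partition function is positive at a point of `U`. -/
instance isOpenPosMeasure_riemannianVolume (g : Metric m M) :
    (riemannianVolume g).IsOpenPosMeasure := by
  refine ⟨fun U hU hne h0 => ?_⟩
  obtain ⟨p, hp⟩ := hne
  obtain ⟨x, hx⟩ := (chartPartition m M).exists_pos_of_mem (mem_univ p)
  have hcont : Continuous (chartPartition m M x) := (chartPartition m M x).contMDiff.continuous
  have hps : p ∈ (chartAt (Euc m) x).source :=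
    chartPartition_tsupport_subset x (subset_tsupport _ hx.ne')
  rw [riemannianVolume, Measure.sum_apply _ hU.measurableSet, ENNReal.tsum_eq_zero] at h0
  have h0x := h0 x
  rw [withDensity_apply_eq_zero' hcont.measurable.ennreal_ofReal.aemeasurable] at h0x
  have hVo : IsOpen (U ∩ {q | 0 < chartPartition m M x q}) :=
    hU.inter (isOpen_lt continuous_const hcont)
  refine chartVolume_ne_zero g x hVo ⟨p, ⟨hp, hx⟩, hps⟩ (measure_mono_null ?_ h0x)
  exact fun q hq => ⟨(ENNReal.ofReal_pos.2 hq.2).ne', hq.1⟩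

/-- A chart measure may be infinite near the edge of its domain; the weight removes this, since its
support lies inside the domain. -/
theorem finiteAt_withDensity_chartPartition (g : Metric m M) (x p : M) :
    ((chartVolume g x).withDensity
      fun q => ENNReal.ofReal (chartPartition m M x q)).FiniteAtFilter (𝓝 p) := by
  by_cases hp : p ∈ tsupport (chartPartition m M x)
  · obtain ⟨W, hW, hfin⟩ := chartVolume_finiteAt g x (chartPartition_tsupport_subset x hp)
    obtain ⟨V, hVW, hVo, hpV⟩ := mem_nhds_iff.1 hW
    refine ⟨V, hVo.mem_nhds hpV, ?_⟩
    rw [withDensity_apply _ hVo.measurableSet]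
    calc ∫⁻ q in V, ENNReal.ofReal (chartPartition m M x q) ∂(chartVolume g x)
        ≤ ∫⁻ _ in V, 1 ∂(chartVolume g x) := lintegral_mono fun q =>
          ENNReal.ofReal_le_one.2 ((chartPartition m M).le_one x q)
      _ = chartVolume g x V := by simp
      _ < ⊤ := (measure_mono hVW).trans_lt hfin
  · have hVo : IsOpen (tsupport (chartPartition m M x))ᶜ := (isClosed_tsupport _).isOpen_compl
    refine ⟨_, hVo.mem_nhds hp, ?_⟩
    rw [withDensity_apply _ hVo.measurableSet, setLIntegral_congr_fun (g := fun _ => 0)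
      hVo.measurableSet fun q hq => by simp [image_eq_zero_of_notMem_tsupport hq]]
    simp

instance isLocallyFiniteMeasure_riemannianVolume (g : Metric m M) :
    IsLocallyFiniteMeasure (riemannianVolume g) := by
  refine ⟨fun p => ?_⟩
  obtain ⟨W, hW, hfin⟩ := (chartPartition m M).locallyFinite p
  choose V hV hVfin using fun x => finiteAt_withDensity_chartPartition g x p
  -- On `W` only finitely many partition functions are not identically zero, so the sum of measures
  -- is finite there.
  have hnhds : W ∩ ⋂ x ∈ hfin.toFinset, V x ∈ 𝓝 p :=
    Filter.inter_mem hW ((Filter.biInter_finset_mem _).2 fun x _ => hV x)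
  obtain ⟨S, hS, hSo, hpS⟩ := mem_nhds_iff.1 hnhds
  refine ⟨S, hSo.mem_nhds hpS, ?_⟩
  rw [riemannianVolume, Measure.sum_apply _ hSo.measurableSet,
    tsum_eq_sum (s := hfin.toFinset)]
  · refine ENNReal.sum_lt_top.2 fun x hx => (measure_mono fun q hq => ?_).trans_lt (hVfin x)
    exact mem_iInter₂.1 (hS hq).2 x hx
  · intro x hx
    rw [withDensity_apply _ hSo.measurableSet, setLIntegral_congr_fun (g := fun _ => 0)
      hSo.measurableSet fun q hq => ?_]
    · simp
    · by_contra hne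
      refine hx (hfin.mem_toFinset.2 ⟨q, fun h0 => hne ?_, (hS hq).1⟩)
      simp [h0]

end VolumeMeasure

/-! ### Variations with prescribed velocities, affine in a chart of the target -/

section Variation

variable {m n : ℕ} {M N : Type*} [TopologicalSpace M] [ChartedSpace (Euc m) M]
  [TopologicalSpace N] [ChartedSpace (Euc n) N] [IsManifold (𝓡 n) ∞ N]

/-- The product of a smooth function and a smooth section of the pullback bundle. -/
def mulFun {φ : C^∞⟮𝓡 m, M; 𝓡 n, N⟯} (f : M → ℝ)
    (hf : ContMDiff (𝓡 m) 𝓘(ℝ, ℝ) ∞ f) (Y : PullbackSection φ) : PullbackSection φ :=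
  ⟨fun p => f p • Y.1 p, fun p => by
    have hY := contMDiffAt_totalSpace.1 (Y.2 p)
    refine contMDiffAt_totalSpace.2 ⟨hY.1, ((hf p).smul hY.2).congr_of_eventuallyEq ?_⟩
    filter_upwards [eventually_mem_trivialization φ p] with q hq
    exact ((trivializationAt (Euc n) (TangentSpace (𝓡 n)) (φ p)).linear ℝ hq).map_smul _ _⟩

/-- The coordinates of a section of the pullback bundle in the chart of the target at `y`. -/
def sectionCoord {φ : C^∞⟮𝓡 m, M; 𝓡 n, N⟯} (y : N) (X : PullbackSection φ) (q : M) : Euc n :=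
  mfderiv (𝓡 n) 𝓘(ℝ, Euc n) (extChartAt (𝓡 n) y) (φ q) (X.1 q)

/-- Over the chart domain, the differential of the chart is the fibre part of the tangent bundle
trivialization at `y`. -/
theorem contMDiffAt_sectionCoord {φ : C^∞⟮𝓡 m, M; 𝓡 n, N⟯} (y : N) (X : PullbackSection φ)
    {q : M} (hq : φ q ∈ (chartAt (Euc n) y).source) :
    ContMDiffAt (𝓡 m) 𝓘(ℝ, Euc n) ∞ (sectionCoord y X) q := by
  set e := trivializationAt (Euc n) (TangentSpace (𝓡 n) : N → Type _) y with he
  have hbase : ∀ r, φ r ∈ (chartAt (Euc n) y).source → φ r ∈ e.baseSet := fun r hr => by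
    simpa [he, TangentBundle.trivializationAt_baseSet] using hr
  have hmem : (⟨φ q, X.1 q⟩ : TangentBundle (𝓡 n) N) ∈ e.source :=
    e.mem_source.2 (hbase q hq)
  have h1 : ContMDiffAt (𝓡 m) ((𝓡 n).prod 𝓘(ℝ, Euc n)) ∞
      (fun r => e (⟨φ r, X.1 r⟩ : TangentBundle (𝓡 n) N)) q :=
    ((Trivialization.contMDiffOn (n := ∞) (IB := 𝓡 n) e).contMDiffAt
      (e.open_source.mem_nhds hmem)).comp q (X.2 q)
  refine h1.snd.congr_of_eventuallyEq ?_
  filter_upwards [φ.contMDiff.continuous.continuousAt.preimage_mem_nhds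
    ((chartAt (Euc n) y).open_source.mem_nhds hq)] with r hr
  have h2 := TangentBundle.continuousLinearMapAt_trivializationAt (I := 𝓡 n) (x₀ := y) hr
  rw [sectionCoord, ← h2]
  exact Trivialization.continuousLinearMapAt_apply_of_mem ℝ e (hbase r hr) (X.1 r)

open Classical in
/-- The variation of `φ` which is affine in the chart of the target at `y`, with velocities `X` and
`Y`. -/
def affineVariation (φ : C^∞⟮𝓡 m, M; 𝓡 n, N⟯) (y : N) (X Y : PullbackSection φ) :
    ℝ × ℝ × M → N := fun z =>
  if φ z.2.2 ∈ (chartAt (Euc n) y).source then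
    (extChartAt (𝓡 n) y).symm (extChartAt (𝓡 n) y (φ z.2.2) + z.1 • sectionCoord y X z.2.2 +
      z.2.1 • sectionCoord y Y z.2.2)
  else φ z.2.2

variable {φ : C^∞⟮𝓡 m, M; 𝓡 n, N⟯} {y : N} {X Y : PullbackSection φ}

theorem affineVariation_of_zero {q : M} (hX : X.1 q = 0) (hY : Y.1 q = 0) (s t : ℝ) :
    affineVariation φ y X Y (s, t, q) = φ q := by
  unfold affineVariation
  split_ifs with hq
  · have hX' : sectionCoord y X q = 0 := by rw [sectionCoord, hX]; exact map_zero _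
    have hY' : sectionCoord y Y q = 0 := by rw [sectionCoord, hY]; exact map_zero _
    simp only [hX', hY', smul_zero, add_zero]
    exact (extChartAt (𝓡 n) y).left_inv (by simpa using hq)
  · rfl

theorem affineVariation_zero_zero (q : M) : affineVariation φ y X Y (0, 0, q) = φ q := by
  unfold affineVariation
  split_ifs with hq
  · simp only [zero_smul, add_zero]
    exact (extChartAt (𝓡 n) y).left_inv (by simpa using hq)
  · rfl

omit [IsManifold (𝓡 n) ∞ N] in
theorem tangentBundle_mk_congr {a b : N} {v w : Euc n} (hab : a = b) (hvw : v = w) :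
    (⟨a, v⟩ : TangentBundle (𝓡 n) N) = ⟨b, w⟩ := by
  subst hab hvw; rfl

/-- Chain rule: the differential of the inverse chart undoes that of the chart, which turned `v`
into `ξ`. -/
theorem tangentMap_affine_chart {b : N} (hb : b ∈ (chartAt (Euc n) y).source)
    (v : TangentSpace (𝓡 n) b) {ξ : Euc n}
    (hξ : ξ = mfderiv (𝓡 n) 𝓘(ℝ, Euc n) (extChartAt (𝓡 n) y) b v) :
    tangentMap 𝓘(ℝ, ℝ) (𝓡 n) (fun s : ℝ => (extChartAt (𝓡 n) y).symm
      (extChartAt (𝓡 n) y b + s • ξ)) ⟨0, (1 : ℝ)⟩ =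
    (⟨b, v⟩ : TangentBundle (𝓡 n) N) := by
  have hb' : b ∈ (extChartAt (𝓡 n) y).source := by simpa using hb
  set a : Euc n := extChartAt (𝓡 n) y b with ha
  have hat : a ∈ (extChartAt (𝓡 n) y).target := (extChartAt (𝓡 n) y).map_source hb'
  have hline : HasMFDerivAt 𝓘(ℝ, ℝ) 𝓘(ℝ, Euc n) (fun s : ℝ => a + s • ξ) 0
      ((ContinuousLinearMap.id ℝ ℝ).smulRight ξ) :=
    (((hasFDerivAt_id (0 : ℝ)).smul_const ξ).const_add a).hasMFDerivAt
  have hsymm : HasMFDerivAt 𝓘(ℝ, Euc n) (𝓡 n) (extChartAt (𝓡 n) y).symm (a + (0 : ℝ) • ξ)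
      (mfderivWithin 𝓘(ℝ, Euc n) (𝓡 n) (extChartAt (𝓡 n) y).symm (range (𝓡 n)) a) := by
    have h := (mdifferentiableWithinAt_extChartAt_symm hat).hasMFDerivWithinAt
    rw [zero_smul, add_zero]
    rw [ModelWithCorners.Boundaryless.range_eq_univ] at h ⊢
    exact hasMFDerivWithinAt_univ.1 h
  have hcomp := hsymm.comp (0 : ℝ) hline
  refine tangentBundle_mk_congr ?_ ?_
  · simp only [zero_smul, add_zero]
    exact (extChartAt (𝓡 n) y).left_inv hb'
  · have hinv := mfderivWithin_extChartAt_symm_comp_mfderiv_extChartAt' (I := 𝓡 n) (x := y) hb'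
    have h1 := hcomp.mfderiv
    have h2 := DFunLike.congr_fun h1 (1 : ℝ)
    refine h2.trans ?_
    have h3 := DFunLike.congr_fun hinv v
    refine Eq.trans ?_ h3
    change mfderivWithin 𝓘(ℝ, Euc n) (𝓡 n) (extChartAt (𝓡 n) y).symm (range (𝓡 n)) a
      ((1 : ℝ) • ξ) = _
    rw [one_smul, hξ]
    rfl

omit [IsManifold (𝓡 n) ∞ N] in
theorem tangentMap_const_fiber (b : N) :
    tangentMap 𝓘(ℝ, ℝ) (𝓡 n) (fun _ : ℝ => b) ⟨0, (1 : ℝ)⟩ =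
      (⟨b, (0 : Euc n)⟩ : TangentBundle (𝓡 n) N) := by
  refine tangentBundle_mk_congr rfl ?_
  rw [mfderiv_const]
  rfl

theorem contMDiffAt_affineVariation {z : ℝ × ℝ × M}
    (hz : φ z.2.2 ∈ (chartAt (Euc n) y).source)
    (ht : extChartAt (𝓡 n) y (φ z.2.2) + z.1 • sectionCoord y X z.2.2 +
      z.2.1 • sectionCoord y Y z.2.2 ∈ (extChartAt (𝓡 n) y).target) :
    ContMDiffAt (𝓘(ℝ, ℝ).prod (𝓘(ℝ, ℝ).prod (𝓡 m))) (𝓡 n) ∞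
      (affineVariation φ y X Y) z := by
  have hs : ContMDiffAt (𝓘(ℝ, ℝ).prod (𝓘(ℝ, ℝ).prod (𝓡 m))) 𝓘(ℝ, ℝ) ∞
      (fun z : ℝ × ℝ × M => z.1) z := contMDiffAt_fst
  have ht' : ContMDiffAt (𝓘(ℝ, ℝ).prod (𝓘(ℝ, ℝ).prod (𝓡 m))) 𝓘(ℝ, ℝ) ∞
      (fun z : ℝ × ℝ × M => z.2.1) z := contMDiffAt_snd.fst
  have hq : ContMDiffAt (𝓘(ℝ, ℝ).prod (𝓘(ℝ, ℝ).prod (𝓡 m))) (𝓡 m) ∞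
      (fun z : ℝ × ℝ × M => z.2.2) z := contMDiffAt_snd.snd
  have hX := (contMDiffAt_sectionCoord y X hz).comp z hq
  have hY := (contMDiffAt_sectionCoord y Y hz).comp z hq
  have hφ := (contMDiffAt_extChartAt' (I := 𝓡 n) (n := ∞) hz).comp z
    ((φ.contMDiff z.2.2).comp z hq)
  have hin := (hφ.add (hs.smul hX)).add (ht'.smul hY)
  have hsymm := (contMDiffOn_extChartAt_symm (I := 𝓡 n) (n := ∞) y).contMDiffAt
    ((isOpen_extChartAt_target y).mem_nhds ht)
  refine (hsymm.comp z hin).congr_of_eventuallyEq ?_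
  have hopen : IsOpen {w : ℝ × ℝ × M | φ w.2.2 ∈ (chartAt (Euc n) y).source} :=
    (chartAt (Euc n) y).open_source.preimage
      (φ.contMDiff.continuous.comp (continuous_snd.comp continuous_snd))
  filter_upwards [hopen.mem_nhds hz] with w hw
  exact if_pos hw

/-- Sections which vanish outside of a compact set that `φ` maps into a chart are the velocities of
a variation. -/
theorem isVariation₂_affineVariation [T2Space M] [SigmaCompactSpace M] [MeasurableSpace M]
    {K : Set M} (hK : IsCompact K) (hKy : ∀ q ∈ K, φ q ∈ (chartAt (Euc n) y).source)
    (hX : ∀ q ∉ K, X.1 q = 0) (hY : ∀ q ∉ K, Y.1 q = 0) :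
    IsVariation₂ φ K X Y (affineVariation φ y X Y) := by
  -- Compactness of `K` yields one `ε` for which the affine motion of all its points stays in the
  -- chart.
  have hev : ∀ᶠ a : ℝ × ℝ in 𝓝 (0, 0), ∀ q ∈ K,
      extChartAt (𝓡 n) y (φ q) + a.1 • sectionCoord y X q + a.2 • sectionCoord y Y q ∈
        (extChartAt (𝓡 n) y).target := by
    refine hK.eventually_forall_of_forall_eventually fun q hq => ?_
    have hcont : ContinuousAt (fun z : (ℝ × ℝ) × M => extChartAt (𝓡 n) y (φ z.2) +
        z.1.1 • sectionCoord y X z.2 + z.1.2 • sectionCoord y Y z.2) ((0, 0), q) := by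
      have h2 : ContinuousAt (fun z : (ℝ × ℝ) × M => z.2) ((0, 0), q) := continuousAt_snd
      have hX := ContinuousAt.comp (x := (((0, 0), q) : (ℝ × ℝ) × M))
        (contMDiffAt_sectionCoord y X (hKy q hq)).continuousAt h2
      have hY := ContinuousAt.comp (x := (((0, 0), q) : (ℝ × ℝ) × M))
        (contMDiffAt_sectionCoord y Y (hKy q hq)).continuousAt h2
      have hφ := ContinuousAt.comp (x := (((0, 0), q) : (ℝ × ℝ) × M))
        (ContinuousAt.comp (continuousAt_extChartAt' (I := 𝓡 n) (x := y)
          (by simpa using hKy q hq)) φ.contMDiff.continuous.continuousAt) h2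
      exact (hφ.add (continuousAt_fst.fst.smul hX)).add (continuousAt_fst.snd.smul hY)
    refine hcont.eventually ((isOpen_extChartAt_target y).mem_nhds ?_)
    simp only [zero_smul, add_zero]
    exact (extChartAt (𝓡 n) y).map_source (by simpa using hKy q hq)
  obtain ⟨ε, hε, hball⟩ := Metric.eventually_nhds_iff.1 hev
  refine ⟨affineVariation_zero_zero, ⟨ε, hε, ?_, ?_⟩, fun q => ?_, fun q => ?_⟩
  · rintro ⟨s, t, q⟩ ⟨hs, ht, -⟩
    refine ContMDiffAt.contMDiffWithinAt ?_
    by_cases hq : q ∈ K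
    · refine contMDiffAt_affineVariation (hKy q hq) (hball (y := (s, t)) ?_ q hq)
      rw [Prod.dist_eq, max_lt_iff, Real.dist_eq, Real.dist_eq, sub_zero, sub_zero]
      exact ⟨abs_lt.2 hs, abs_lt.2 ht⟩
    -- `K` is closed, so off `K` the variation equals `φ` on a whole neighbourhood.
    · have hcomp : ContMDiffAt (𝓘(ℝ, ℝ).prod (𝓘(ℝ, ℝ).prod (𝓡 m))) (𝓡 n) ∞
          (fun w : ℝ × ℝ × M => φ w.2.2) (s, t, q) :=
        (φ.contMDiff q).comp (s, t, q) contMDiffAt_snd.snd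
      refine hcomp.congr_of_eventuallyEq ?_
      have hopen : IsOpen {w : ℝ × ℝ × M | w.2.2 ∈ Kᶜ} :=
        hK.isClosed.isOpen_compl.preimage (continuous_snd.comp continuous_snd)
      filter_upwards [hopen.mem_nhds hq] with w hw
      exact affineVariation_of_zero (hX _ hw) (hY _ hw) _ _
  · exact fun s _ t _ q hq => affineVariation_of_zero (hX _ hq) (hY _ hq) _ _
  · by_cases hq : q ∈ K
    · refine Eq.trans ?_ (tangentMap_affine_chart (hKy q hq) (X.1 q)
        (ξ := sectionCoord y X q) rfl)
      congr 1
      funext s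
      simp [affineVariation, hKy q hq]
    · simp only [affineVariation_of_zero (hX _ hq) (hY _ hq), hX _ hq]
      exact tangentMap_const_fiber _
  · by_cases hq : q ∈ K
    · refine Eq.trans ?_ (tangentMap_affine_chart (hKy q hq) (Y.1 q)
        (ξ := sectionCoord y Y q) rfl)
      congr 1
      funext s
      simp [affineVariation, hKy q hq]
    · simp only [affineVariation_of_zero (hX _ hq) (hY _ hq), hY _ hq]
      exact tangentMap_const_fiber _

end Variation

/-! ### Uniqueness of the Jacobi operator -/

section Uniqueness

variable {m n : ℕ} {M N : Type*} [TopologicalSpace M] [ChartedSpace (Euc m) M]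
  [IsManifold (𝓡 m) ∞ M] [T2Space M] [SigmaCompactSpace M] [MeasurableSpace M] [BorelSpace M]
  [TopologicalSpace N] [ChartedSpace (Euc n) N] [IsManifold (𝓡 n) ∞ N]
  {g : Metric m M} {h : Metric n N} {φ : C^∞⟮𝓡 m, M; 𝓡 n, N⟯}

omit [IsManifold (𝓡 m) ∞ M] [T2Space M] [SigmaCompactSpace M] [MeasurableSpace M] [BorelSpace M] in
theorem continuous_inner_section (h : Metric n N) (X Y : PullbackSection φ) :
    Continuous fun p => h.inner (φ p) (X.1 p) (Y.1 p) :=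
  ContMDiff.continuous (I := 𝓡 m) (I' := 𝓘(ℝ, ℝ)) (n := ∞) fun p =>
    contMDiffWithinAt_inner_along (s := univ) h (X.2 p) (Y.2 p)

omit [BorelSpace M] in
/-- A Jacobi operator does not depend on the values of a section away from a point. -/
theorem IsJacobiOperator.apply_mulFun {J : PullbackSection φ →ₗ[ℝ] PullbackSection φ}
    (hJ : IsJacobiOperator g h φ J) {f : M → ℝ} (hf : ContMDiff (𝓡 m) 𝓘(ℝ, ℝ) ∞ f)
    {p : M} (hfp : f =ᶠ[𝓝 p] 1) (Y : PullbackSection φ) :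
    (J (mulFun f hf Y)).1 p = (J Y).1 p := by
  have h0 : (J (Y - mulFun f hf Y)).1 p = 0 := by
    refine hJ.isLocal _ p ?_
    filter_upwards [hfp] with q hq
    change Y.1 q - f q • Y.1 q = 0
    rw [hq, Pi.one_apply, one_smul, sub_self]
  rw [map_sub] at h0
  exact (sub_eq_zero.1 h0).symm

/-- The Jacobi operator is unique. -/
theorem IsJacobiOperator.unique {J J' : PullbackSection φ →ₗ[ℝ] PullbackSection φ}
    (hJ : IsJacobiOperator g h φ J) (hJ' : IsJacobiOperator g h φ J') : J = J' := by
  refine LinearMap.ext fun Y => Subtype.ext (funext fun p => ?_)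
  have hU : φ ⁻¹' (chartAt (Euc n) (φ p)).source ∈ 𝓝 p :=
    φ.contMDiff.continuous.continuousAt.preimage_mem_nhds
      ((chartAt (Euc n) (φ p)).open_source.mem_nhds (mem_chart_source _ _))
  obtain ⟨f, -, hfU⟩ := (SmoothBumpFunction.nhds_basis_tsupport (I := 𝓡 m) p).mem_iff.1 hU
  have hf : ContMDiff (𝓡 m) 𝓘(ℝ, ℝ) ∞ f := f.contMDiff
  set W := mulFun f hf Y with hW
  -- Since `f = 1` near `p`, locality lets the compactly supported `W` replace `Y` at `p`.
  rw [← hJ.apply_mulFun hf f.eventuallyEq_one Y, ← hJ'.apply_mulFun hf f.eventuallyEq_one Y, ← hW]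
  set Z := J W - J' W with hZ
  -- The test section is the difference itself, cut off so that a variation realizes it together
  -- with `W`.
  set X := mulFun f hf Z with hX
  have hzero : ∀ (V : PullbackSection φ), ∀ q ∉ tsupport f, (mulFun f hf V).1 q = 0 := by
    intro V q hq
    change f q • V.1 q = 0
    rw [image_eq_zero_of_notMem_tsupport hq, zero_smul]
  have hvar := isVariation₂_affineVariation (y := φ p) f.hasCompactSupport.isCompact hfU
    (hzero Z) (hzero Y)
  have hint : ∫ q, h.inner (φ q) (X.1 q) ((J W).1 q) ∂(riemannianVolume g) =
      ∫ q, h.inner (φ q) (X.1 q) ((J' W).1 q) ∂(riemannianVolume g) :=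
    (hJ.hessian _ _ _ _ f.hasCompactSupport.isCompact hvar).unique
      (hJ'.hessian _ _ _ _ f.hasCompactSupport.isCompact hvar)
  have hintegrable : ∀ V : PullbackSection φ,
      Integrable (fun q => h.inner (φ q) (X.1 q) (V.1 q)) (riemannianVolume g) := fun V => by
    refine (continuous_inner_section h X V).integrable_of_hasCompactSupport
      (HasCompactSupport.intro f.hasCompactSupport.isCompact fun q hq => ?_)
    rw [hX, hzero Z q hq]
    simp
  have hsub : ∫ q, h.inner (φ q) (X.1 q) (Z.1 q) ∂(riemannianVolume g) = 0 := by
    rw [← sub_eq_zero.2 hint, ← integral_sub (hintegrable _) (hintegrable _)]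
    refine integral_congr_ae (Filter.Eventually.of_forall fun q => ?_)
    exact map_sub (h.inner (φ q) (X.1 q)) ((J W).1 q) ((J' W).1 q)
  have hXZ : ∀ q, h.inner (φ q) (X.1 q) (Z.1 q) = f q * h.inner (φ q) (Z.1 q) (Z.1 q) :=
    fun q => by
      change h.inner (φ q) (f q • Z.1 q) (Z.1 q) = _
      rw [map_smul]
      rfl
  have hnonneg : 0 ≤ fun q => h.inner (φ q) (X.1 q) (Z.1 q) := fun q => by
    change 0 ≤ h.inner (φ q) (X.1 q) (Z.1 q)
    rw [hXZ]
    refine mul_nonneg f.nonneg ?_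
    by_cases hq : Z.1 q = 0
    · rw [hq]; simp
    · exact (h.pos _ _ hq).le
  have hae := (integral_eq_zero_iff_of_nonneg hnonneg (hintegrable Z)).1 hsub
  -- Open sets have positive volume, so a.e. vanishing of a continuous function is vanishing
  -- everywhere, in particular at `p`.
  have heq := (Continuous.ae_eq_iff_eq _ (continuous_inner_section h X Z) continuous_const).1 hae
  have hp : h.inner (φ p) (Z.1 p) (Z.1 p) = 0 := by
    have h1 : h.inner (φ p) (X.1 p) (Z.1 p) = 0 := congrFun heq p
    rwa [hXZ, f.eq_one, one_mul] at h1
  have hZp : Z.1 p = 0 := by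
    by_contra hne
    exact (h.pos _ _ hne).ne' hp
  exact sub_eq_zero.1 hZp

end Uniqueness

end HarmonicMaps

end

theorem mainTheorem7 {m n : ℕ}
    {M : Type*} [TopologicalSpace M] [ChartedSpace (HarmonicMaps.Euc m) M]
    [IsManifold (𝓡 m) ∞ M] [T2Space M] [SigmaCompactSpace M] [MeasurableSpace M] [BorelSpace M]
    {N : Type*} [TopologicalSpace N] [ChartedSpace (HarmonicMaps.Euc n) N]
    [IsManifold (𝓡 n) ∞ N]
    (g : HarmonicMaps.Metric m M) (h : HarmonicMaps.Metric n N)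
    (φ : C^∞⟮𝓡 m, M; 𝓡 n, N⟯) (hφ : HarmonicMaps.IsHarmonic g h φ)
    (J : HarmonicMaps.PullbackSection φ →ₗ[ℝ] HarmonicMaps.PullbackSection φ)
    (hJ : HarmonicMaps.IsJacobiOperator g h φ J)
    (R₁ R₂ : ℝ) (hR₁ : 0 < R₁) (hR₂ : 0 < R₂) :
    HarmonicMaps.IsHarmonic (g.rescale R₁ hR₁) (h.rescale R₂ hR₂) φ ∧
    HarmonicMaps.IsJacobiOperator (g.rescale R₁ hR₁) (h.rescale R₂ hR₂) φ ((R₁ ^ 2)⁻¹ • J) ∧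
    ∀ J' : HarmonicMaps.PullbackSection φ →ₗ[ℝ] HarmonicMaps.PullbackSection φ,
      HarmonicMaps.IsJacobiOperator (g.rescale R₁ hR₁) (h.rescale R₂ hR₂) φ J' →
        J' = (R₁ ^ 2)⁻¹ • J :=
  ⟨hφ.rescale hR₁ hR₂, hJ.rescale hR₁ hR₂, fun _ hJ' => hJ'.unique (hJ.rescale hR₁ hR₂)⟩
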